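/- A directed graph $G$ has a finite vertex set $V(G)$ and a finite edge set $E(G)$; every edge has an initial and a terminal vertex, and loops and multiple edges are allowed. A directed path from $u$ to $v\neq u$ is a sequence $u=v_0,x_0,v_1,\dots,x_{n-1},v_n=v$ with pairwise distinct vertices $v_i$, where the edge $x_i$ has initial vertex $v_i$ and terminal vertex $v_{i+1}$. For a vertex $w$ with outgoing edges $x_1,\dots,x_m$ and incoming edges $y_1,\dots,y_n$, and for $1\le l\le\max\{m,n\}$, put $\delta_{w,l}=e_l(x_1,\dots,x_m)-e_l(y_1,\dots,y_n)\in\mathbb Z[E(G)]$, where $e_l$ is the $l$-th elementary symmetric polynomial. The Khovanov–Rozansky complex $\mathscr C_*(G)$ is the Koszul complex over $\mathbb Z[E(G)]$ of the family of all $\delta_{w,l}$. Let $\mathscr H_*(G)$ be its homology, with degree $0$ part $\mathscr H_0(G)$, and let $\mathscr H^{\mathbb Q}_*(G)$ be the homology of $\mathbb Q\otimes_{\mathbb Z}\mathscr C_*(G)$. For a commutative ring $R$ and an $R$-module $M$ put $\mathrm{Kdim}_R M=\mathrm{Kdim}(R/\mathrm{ann}_R M)$, the Krull dimension of $R/\mathrm{ann}_R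 M$. For a set $E\subseteq E(G)$ of edges, $\mathbb Z[E]\subseteq\mathbb Z[E(G)]$ and $\mathbb Q[E]\subseteq\mathbb Q[E(G)]$ are the polynomial subrings in the variables from $E$. Let $u\ne v$ be vertices of a directed graph $G$. Let $G_{u\to v}$ be the directed graph obtained from $G$ by deleting all edges with terminal vertex $u$ and all edges with initial vertex $v$ and then identifying $u$ and $v$ to a single vertex $u\#v$. Let $E(u\#v)$ be the set of edges of $G_{u\to v}$ incident at $u\#v$. Let $\alpha_{u\to v}(G)$ be the maximal number of pairwise edge-disjoint directed paths in $G$ from $u$ to $v$, and let $\beta_{u\to v}(G)$ be the minimal number of edges of $G$ incident at $u$ or $v$ whose removal from $G$ destroys all directed paths from $u$ to $v$. 1. The following are equivalent: (1) there is no directed path in $G$ from $u$ to $v$; (2) $\mathbb Z[E(u\#v)]/\mathrm{ann}_{\mathbb Z[E(u\#v)]}(\mathscr H_0(G_{u\to v}))$ is a finitely generated $\mathbb Z$-module; (3) $\mathbb Z[E(u\#v)]/\mathrm{ann}_{\mathbb Z[E(u\#v)]}(\mathscr H_*(G_{u\to v}))$ is a finitely generated $\mathbb Z$-module; (4) $\mathrm{Kdim}_{\mathbb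 Z[E(u\#v)]}\,\mathscr H_0(G_{u\to v})=1$; (5) $\mathrm{Kdim}_{\mathbb Q[E(u\#v)]}\,\mathscr H_0^{\mathbb Q}(G_{u\to v})=0$. 2. $\alpha_{u\to v}(G)\le\mathrm{Kdim}_{\mathbb Q[E(u\#v)]}\,\mathscr H_0^{\mathbb Q}(G_{u\to v})\le\mathrm{Kdim}_{\mathbb Z[E(u\#v)]}\,\mathscr H_0(G_{u\to v})-1\le\beta_{u\to v}(G)$. -/

import Mathlib

open scoped DirectSum

noncomputable section

/-- A directed graph with vertex set `V` and edge set `E`; loops and multiple edges are allowed. -/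
structure DirGraph (V E : Type*) where
  /-- the initial vertex of an edge -/
  init : E → V
  /-- the terminal vertex of an edge -/
  term : E → V

/-- The Krull dimension of an `R`-module `M`, that is, of the ring `R / ann_R M`. -/
def Kdim (R M : Type*) [CommRing R] [AddCommGroup M] [Module R M] : WithBot ℕ∞ :=
  ringKrullDim (R ⧸ Module.annihilator R M)

namespace Koszul

section Homology

variable {R M : Type*} [CommRing R] [AddCommGroup M] [Module R M]

/-- Degree `n` cycles of an endomorphism `d` (to be thought of as a differential lowering degrees
by one) of a module with graded pieces `A n`. -/
abbrev cycles (d : M →ₗ[R] M) (A : ℕ → Submodule R M) (n : ℕ) : Submodule R M :=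
  LinearMap.ker d ⊓ A n

/-- The `n`-th homology: the degree `n` cycles modulo the image under `d` of the degree `n + 1`
part. In degree `0` of a nonnegatively graded complex every element is a cycle. -/
abbrev homology (d : M →ₗ[R] M) (A : ℕ → Submodule R M) (n : ℕ) : Type _ :=
  ↥(cycles d A n) ⧸ ((A (n + 1)).map d).submoduleOf (cycles d A n)

end Homology

section Complex

variable {R : Type*} [CommRing R] {ι : Type*}

/-- The Koszul complex of a family `r` of elements of `R` has as underlying module the exterior
algebra of the free module on the index set. -/
abbrev Carrier (R ι : Type*) [CommRing R] : Type _ := ExteriorAlgebra R (ι →₀ R)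

/-- The differential of the Koszul complex of the family `r`: contraction with the linear form
`e_i ↦ r i`. So `d (e_{i_1} ∧ ⋯ ∧ e_{i_n})` is the alternating sum, starting with a plus sign, of
the elements `r i_j • e_{i_1} ∧ ⋯ ∧ e_{i_n}` with the factor `e_{i_j}` omitted. -/
def d (r : ι → R) : Carrier R ι →ₗ[R] Carrier R ι :=
  CliffordAlgebra.contractLeft (Finsupp.linearCombination R r)

/-- The part of the Koszul complex in homological degree `n`: the `n`-th exterior power. -/
abbrev piece (R ι : Type*) [CommRing R] (n : ℕ) : Submodule R (Carrier R ι) :=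
  ⋀[R]^n (ι →₀ R)

theorem d_d (r : ι → R) (x : Carrier R ι) : d r (d r x) = 0 :=
  CliffordAlgebra.contractLeft_contractLeft _ _

theorem d_mem (r : ι → R) (n : ℕ) {x : Carrier R ι} (hx : x ∈ piece R ι (n + 1)) :
    d r x ∈ piece R ι n := by
  induction n generalizing x with
  | zero =>
    change x ∈ LinearMap.range (ExteriorAlgebra.ι R) ^ (0 + 1) at hx
    rw [zero_add, pow_one] at hx
    obtain ⟨m, rfl⟩ := hx
    have h : d r (ExteriorAlgebra.ι R m) = algebraMap R _ (Finsupp.linearCombination R r m) :=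
      CliffordAlgebra.contractLeft_ι (0 : QuadraticForm R (ι →₀ R)) _ m
    change _ ∈ LinearMap.range (ExteriorAlgebra.ι R) ^ 0
    rw [h, pow_zero]
    exact Submodule.algebraMap_mem _
  | succ k ih =>
    change x ∈ LinearMap.range (ExteriorAlgebra.ι R) ^ (k + 1 + 1) at hx
    rw [pow_succ'] at hx
    refine Submodule.mul_induction_on hx ?_ ?_
    · rintro _ ⟨m, rfl⟩ y hy
      have h := CliffordAlgebra.contractLeft_ι_mul (Q := (0 : QuadraticForm R (ι →₀ R)))
        (d := Finsupp.linearCombination R r) m y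
      have h2 : ExteriorAlgebra.ι R m * d r y ∈ piece R ι (k + 1) := by
        change _ ∈ LinearMap.range (ExteriorAlgebra.ι R) ^ (k + 1)
        rw [pow_succ']
        exact Submodule.mul_mem_mul ⟨m, rfl⟩ (ih hy)
      exact h ▸ Submodule.sub_mem _ (Submodule.smul_mem _ _ hy) h2
    · intro a b ha hb
      rw [map_add]
      exact Submodule.add_mem _ ha hb

theorem boundaries_le_cycles (r : ι → R) (n : ℕ) :
    (piece R ι (n + 1)).map (d r) ≤ cycles (d r) (piece R ι) n := by
  rintro _ ⟨x, hx, rfl⟩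
  exact ⟨d_d r x, d_mem r n hx⟩

end Complex

end Koszul

namespace DirGraph

variable {V E : Type*}

/-- A directed path from `u` to `v`: pairwise distinct vertices `u = v_0, …, v_n = v` and edges
`x_0, …, x_{n-1}`, where `x_i` goes from `v_i` to `v_{i+1}`. -/
structure DirPath (G : DirGraph V E) (u v : V) where
  length : ℕ
  vert : Fin (length + 1) → V
  edge : Fin length → E
  vert_injective : Function.Injective vert
  vert_zero : vert 0 = u
  vert_last : vert (Fin.last length) = v
  init_edge : ∀ i, G.init (edge i) = vert i.castSucc
  term_edge : ∀ i, G.term (edge i) = vert i.succ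

/-- The set of edges of a directed path. -/
def DirPath.edgeSet {G : DirGraph V E} {u v : V} (P : G.DirPath u v) : Set E :=
  Set.range P.edge

/-- The edges incident at a vertex. -/
def incident (G : DirGraph V E) (w : V) : Set E := {e | G.init e = w ∨ G.term e = w}

/-- The graph obtained by removing a set of edges. -/
def deleteEdges (G : DirGraph V E) (S : Set E) : DirGraph V {e : E // e ∉ S} where
  init e := G.init e
  term e := G.term e

/-- The vertex set obtained from `V` by identifying `u` and `v`. -/
abbrev Glued (u v : V) : Type _ := Quot (fun a b : V => a = u ∧ b = v)

/-- The graph obtained by identifying the vertices `u` and `v`. -/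
def identify (G : DirGraph V E) (u v : V) : DirGraph (Glued u v) E where
  init e := Quot.mk _ (G.init e)
  term e := Quot.mk _ (G.term e)

/-- The edges deleted in forming `G_{u → v}`: those into `u` and those out of `v`. -/
def badEdges (G : DirGraph V E) (u v : V) : Set E := {e | G.term e = u ∨ G.init e = v}

/-- The graph `G_{u → v}`: delete all edges into `u` and all edges out of `v`, and then identify
`u` and `v`. -/
def pathGraph (G : DirGraph V E) (u v : V) :
    DirGraph (Glued u v) {e : E // e ∉ G.badEdges u v} :=
  (G.deleteEdges (G.badEdges u v)).identify u v

/-- The vertex `u # v` of `G_{u → v}` that comes from `u` and `v`. -/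
def gluedVertex (u v : V) : Glued u v := Quot.mk _ u

/-- The set of edges of `G_{u → v}` incident at `u # v`. -/
abbrev gluedEdges (G : DirGraph V E) (u v : V) : Set {e : E // e ∉ G.badEdges u v} :=
  (G.pathGraph u v).incident (gluedVertex u v)

/-- The maximal number of pairwise edge-disjoint directed paths from `u` to `v`
(used for `u ≠ v` and finitely many edges, where these numbers are bounded). -/
def alphaPath (G : DirGraph V E) (u v : V) : ℕ :=
  sSup {k | ∃ P : Fin k → G.DirPath u v,
    Pairwise fun i j => Disjoint (P i).edgeSet (P j).edgeSet}

/-- The minimal number of edges incident at `u` or `v` whose removal destroys all directed paths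
from `u` to `v`. -/
def betaPath (G : DirGraph V E) (u v : V) : ℕ :=
  sInf {k | ∃ S : Finset E, (S : Set E) ⊆ G.incident u ∪ G.incident v ∧
    IsEmpty ((G.deleteEdges (S : Set E)).DirPath u v) ∧ S.card = k}

section Incidence

variable [Finite E]

/-- The edges with initial vertex `w`. -/
def outEdges (G : DirGraph V E) (w : V) : Finset E := (Set.toFinite {e | G.init e = w}).toFinset

/-- The edges with terminal vertex `w`. -/
def inEdges (G : DirGraph V E) (w : V) : Finset E := (Set.toFinite {e | G.term e = w}).toFinset

/-- The index set of the incidence relations: pairs of a vertex `w` and a number `i` with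
`0 ≤ i < max (outdeg w) (indeg w)`, which stands for the degree `i + 1`. -/
abbrev RelIndex (G : DirGraph V E) : Type _ :=
  Σ w : V, Fin (max (G.outEdges w).card (G.inEdges w).card)

/-- The incidence relation `e_l(x_1, …, x_m) - e_l(y_1, …, y_n)` at `w`, where the `x_i` are the
edges out of `w`, the `y_j` are the edges into `w`, and `l = i + 1`. -/
def relation (G : DirGraph V E) (p : G.RelIndex) : MvPolynomial E ℤ :=
  ((G.outEdges p.1).val.map MvPolynomial.X).esymm (p.2 + 1) -
    ((G.inEdges p.1).val.map MvPolynomial.X).esymm (p.2 + 1)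

/-- The `n`-th Khovanov-Rozansky homology of `G`, a module over `ℤ[E]`: the homology of the Koszul
complex of all incidence relations. -/
abbrev KRHomology (G : DirGraph V E) (n : ℕ) : Type _ :=
  Koszul.homology (Koszul.d G.relation) (Koszul.piece (MvPolynomial E ℤ) G.RelIndex) n

/-- The total Khovanov-Rozansky homology of `G`. -/
abbrev KRHomologyTotal (G : DirGraph V E) : Type _ := ⨁ n : ℕ, G.KRHomology n

attribute [local instance] MvPolynomial.algebraMvPolynomial

/-- The `n`-th Khovanov-Rozansky homology of `G` over `ℚ`, a module over `ℚ[E]`: the homology of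
the Koszul complex `C` tensored with `ℚ` over `ℤ`, which is written here as
`ℚ[E] ⊗ C` over `ℤ[E]`. -/
abbrev KRHomologyRat (G : DirGraph V E) (n : ℕ) : Type _ :=
  Koszul.homology ((Koszul.d G.relation).baseChange (MvPolynomial E ℚ))
    (fun k => (Koszul.piece (MvPolynomial E ℤ) G.RelIndex k).baseChange (MvPolynomial E ℚ)) n

end Incidence

end DirGraph

end

/-! Degree 0 of the Koszul complex is generated by 1, so the annihilator of `KRHomology 0` is the
ideal of the incidence relations, and this ideal kills the higher homology too
(`span_le_annihilator_homology`). Hence conditions (2) and (3) agree, and every dimension in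
question is that of a polynomial subring modulo the contraction of `relationIdeal`.

A homomorphism from the polynomial ring to a domain kills the relations exactly when the values of
the variables form a balanced labelling (`balanced_iff_relation_eq_zero`), because elementary
symmetric polynomials determine a multiset up to zeros. Dimensions are therefore governed by the
number of distinct nonzero labels at `u # v`.

Upper bound: each nonzero label behaves like a conserved flow from `u` to `v`, so it occurs on every
cut (`exists_mem_of_balanced`). Modulo a prime, the subring is then generated by at most as many
elements as the cut has edges. For the empty cut the variables at `u # v` are nilpotent, which gives
finiteness.

Lower bound: a balanced labelling stays balanced when its nonzero labels are replaced by independent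
variables, so it yields a polynomial ring as a quotient (`le_ringKrullDim_of_label`). Edge-disjoint
paths are such labels. So are the values of the variables modulo a prime of `ℚ[E]`; used over `ℤ`,
of dimension 1, they compare the two coefficient rings (`ringKrullDim_rat_add_one_le`). -/

namespace Koszul

/-! ### Annihilators of Koszul homology. -/

section Annihilator

variable {R : Type*} [CommRing R] {ι : Type*} (r : ι → R)

theorem one_mem_piece_zero : (1 : Carrier R ι) ∈ piece R ι 0 := by
  change _ ∈ LinearMap.range (ExteriorAlgebra.ι R) ^ 0
  rw [pow_zero]
  exact Submodule.one_le.mp le_rfl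

theorem mem_piece_zero {x : Carrier R ι} (hx : x ∈ piece R ι 0) :
    ∃ a : R, x = algebraMap R _ a := by
  change _ ∈ LinearMap.range (ExteriorAlgebra.ι R) ^ 0 at hx
  rw [pow_zero, Submodule.mem_one] at hx
  obtain ⟨a, rfl⟩ := hx
  exact ⟨a, rfl⟩

theorem mem_piece_one {x : Carrier R ι} (hx : x ∈ piece R ι 1) :
    ∃ m, x = ExteriorAlgebra.ι R m := by
  change _ ∈ LinearMap.range (ExteriorAlgebra.ι R) ^ 1 at hx
  rw [pow_one] at hx
  obtain ⟨a, rfl⟩ := hx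
  exact ⟨a, rfl⟩

theorem ι_mul_mem_piece (m : ι →₀ R) {n : ℕ} {x : Carrier R ι} (hx : x ∈ piece R ι n) :
    ExteriorAlgebra.ι R m * x ∈ piece R ι (n + 1) := by
  change _ ∈ LinearMap.range (ExteriorAlgebra.ι R) ^ (n + 1)
  rw [pow_succ']
  exact Submodule.mul_mem_mul ⟨m, rfl⟩ hx

theorem ι_mem_piece_one (m : ι →₀ R) : ExteriorAlgebra.ι R m ∈ piece R ι 1 := by
  simp

theorem d_ι (m : ι →₀ R) :
    d r (ExteriorAlgebra.ι R m) = algebraMap R _ (Finsupp.linearCombination R r m) :=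
  CliffordAlgebra.contractLeft_ι (0 : QuadraticForm R (ι →₀ R)) _ m

theorem d_ι_mul (m : ι →₀ R) (x : Carrier R ι) :
    d r (ExteriorAlgebra.ι R m * x) =
      Finsupp.linearCombination R r m • x - ExteriorAlgebra.ι R m * d r x :=
  CliffordAlgebra.contractLeft_ι_mul (Q := (0 : QuadraticForm R (ι →₀ R)))
    (d := Finsupp.linearCombination R r) m x

theorem linearCombination_mem_span (m : ι →₀ R) :
    Finsupp.linearCombination R r m ∈ Ideal.span (Set.range r) := by
  rw [← Ideal.submodule_span_eq, ← Finsupp.range_linearCombination]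
  exact ⟨m, rfl⟩

/-- The members of the family annihilate the homology of its Koszul complex. -/
theorem span_le_annihilator_homology (n : ℕ) :
    Ideal.span (Set.range r) ≤ Module.annihilator R (homology (d r) (piece R ι) n) := by
  intro a ha
  rw [← Ideal.submodule_span_eq, ← Finsupp.range_linearCombination] at ha
  obtain ⟨m, rfl⟩ := ha
  rw [Module.mem_annihilator]
  intro z
  obtain ⟨⟨x, hx⟩, rfl⟩ := Submodule.Quotient.mk_surjective _ z
  rw [← Submodule.Quotient.mk_smul, Submodule.Quotient.mk_eq_zero]
  -- Left multiplication by `ι m` is a contracting homotopy for the scalar `a`: on a cycle `x`, the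
  -- boundary of `ι m * x` is `a • x`.
  refine ⟨ExteriorAlgebra.ι R m * x, ι_mul_mem_piece m hx.2, ?_⟩
  have h0 : d r x = 0 := hx.1
  rw [d_ι_mul, h0, mul_zero, sub_zero]
  rfl

/-- A scalar that kills the class of 1 is itself a degree 0 boundary, that is, a linear combination
of the `r i`. -/
theorem annihilator_homology_zero :
    Module.annihilator R (homology (d r) (piece R ι) 0) = Ideal.span (Set.range r) := by
  refine le_antisymm (fun a ha => ?_) (span_le_annihilator_homology r 0)
  have h1 : (1 : Carrier R ι) ∈ cycles (d r) (piece R ι) 0 :=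
    ⟨CliffordAlgebra.contractLeft_one (0 : QuadraticForm R (ι →₀ R)) _, one_mem_piece_zero⟩
  have h := Module.mem_annihilator.mp ha (Submodule.Quotient.mk ⟨1, h1⟩)
  rw [← Submodule.Quotient.mk_smul, Submodule.Quotient.mk_eq_zero] at h
  obtain ⟨y, hy, hyd⟩ := h
  obtain ⟨m, rfl⟩ := mem_piece_one hy
  have h2 : algebraMap R (Carrier R ι) (Finsupp.linearCombination R r m) = a • 1 :=
    (d_ι r m).symm.trans hyd
  rw [← Algebra.algebraMap_eq_smul_one] at h2
  rw [← (ExteriorAlgebra.algebraMap_leftInverse _).injective h2]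
  exact linearCombination_mem_span r m

variable (S : Type*) [CommRing S] [Algebra R S]

-- The argument runs inside the tensor product, without identifying it with an exterior algebra over
-- `S`: degree 0 consists of the `S`-multiples of `1 ⊗ₜ 1`, and the augmentation `ε` reads off the
-- coefficient.
open TensorProduct in
theorem annihilator_homology_zero_baseChange :
    Module.annihilator S
      (homology ((d r).baseChange S) (fun k => (piece R ι k).baseChange S) 0) =
      Ideal.span (Set.range fun i => algebraMap R S (r i)) := by
  set J := Ideal.span (Set.range fun i => algebraMap R S (r i)) with hJ
  have hlin : ∀ m : ι →₀ R, algebraMap R S (Finsupp.linearCombination R r m) ∈ J := by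
    intro m
    rw [hJ, Set.range_comp' (algebraMap R S) r, ← Ideal.map_span]
    exact Ideal.mem_map_of_mem _ (linearCombination_mem_span r m)
  have h1 : (1 ⊗ₜ 1 : S ⊗[R] Carrier R ι) ∈
      cycles ((d r).baseChange S) (fun k => (piece R ι k).baseChange S) 0 := by
    refine ⟨?_, Submodule.tmul_mem_baseChange_of_mem _ one_mem_piece_zero⟩
    have h : d r (1 : Carrier R ι) = 0 :=
      CliffordAlgebra.contractLeft_one (0 : QuadraticForm R (ι →₀ R)) _
    change (d r).baseChange S (1 ⊗ₜ 1) = 0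
    rw [LinearMap.baseChange_tmul, h, tmul_zero]
  refine le_antisymm (fun a ha => ?_) (fun a ha => ?_)
  · let ε : S ⊗[R] Carrier R ι →ₗ[S] S :=
      (AlgebraTensorModule.rid R S S).toLinearMap ∘ₗ
        (ExteriorAlgebra.algebraMapInv (R := R) (M := ι →₀ R)).toLinearMap.baseChange S
    have hε : ∀ s x, ε (s ⊗ₜ x) = ExteriorAlgebra.algebraMapInv x • s := fun s x => rfl
    have hle : ((piece R ι 1).baseChange S).map ((d r).baseChange S) ≤ Submodule.comap ε J := by
      rw [Submodule.baseChange_eq_span, Submodule.map_span, Submodule.span_le]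
      rintro _ ⟨_, ⟨x, hx, rfl⟩, rfl⟩
      obtain ⟨m, rfl⟩ := mem_piece_one hx
      change ε ((d r).baseChange S (1 ⊗ₜ _)) ∈ J
      rw [LinearMap.baseChange_tmul, d_ι, hε, ExteriorAlgebra.algebraMap_leftInverse,
        Algebra.smul_def, mul_one]
      exact hlin m
    have h := Module.mem_annihilator.mp ha (Submodule.Quotient.mk ⟨1 ⊗ₜ 1, h1⟩)
    rw [← Submodule.Quotient.mk_smul, Submodule.Quotient.mk_eq_zero] at h
    have h2 : ε (a • (1 ⊗ₜ 1 : S ⊗[R] Carrier R ι)) ∈ J := hle h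
    have h3 : ε (1 ⊗ₜ 1) = 1 := by
      rw [hε, map_one ExteriorAlgebra.algebraMapInv, one_smul]
    rwa [LinearMap.map_smul, h3, smul_eq_mul, mul_one] at h2
  · have hJle : J ≤ (((piece R ι 1).baseChange S).map ((d r).baseChange S)).comap
        (LinearMap.toSpanSingleton S _ (1 ⊗ₜ 1 : S ⊗[R] Carrier R ι)) := by
      rw [hJ, Ideal.span_le]
      rintro _ ⟨i, rfl⟩
      refine ⟨1 ⊗ₜ ExteriorAlgebra.ι R (Finsupp.single i 1),
        Submodule.tmul_mem_baseChange_of_mem _ (ι_mem_piece_one _), ?_⟩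
      rw [LinearMap.baseChange_tmul, d_ι, Finsupp.linearCombination_single, one_smul,
        LinearMap.toSpanSingleton_apply, smul_tmul', Algebra.algebraMap_eq_smul_one, ← smul_tmul]
      simp only [Algebra.smul_def, mul_one, Algebra.algebraMap_self_apply]
    rw [Module.mem_annihilator]
    intro z
    obtain ⟨⟨x, hx⟩, rfl⟩ := Submodule.Quotient.mk_surjective _ z
    rw [← Submodule.Quotient.mk_smul, Submodule.Quotient.mk_eq_zero]
    have hx2 : x ∈ Submodule.span S {(1 ⊗ₜ 1 : S ⊗[R] Carrier R ι)} := by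
      have hx3 : x ∈ (piece R ι 0).baseChange S := hx.2
      rw [Submodule.baseChange_eq_span] at hx3
      refine Submodule.span_le.mpr ?_ hx3
      rintro _ ⟨y, hy, rfl⟩
      obtain ⟨b, rfl⟩ := mem_piece_zero hy
      refine Submodule.mem_span_singleton.mpr ⟨algebraMap R S b, ?_⟩
      change _ = (1 : S) ⊗ₜ[R] _
      rw [smul_tmul', Algebra.algebraMap_eq_smul_one, Algebra.algebraMap_eq_smul_one,
        ← smul_tmul, smul_eq_mul, mul_one]
    obtain ⟨s, rfl⟩ := Submodule.mem_span_singleton.mp hx2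
    have h2 : a • s • (1 ⊗ₜ 1 : S ⊗[R] Carrier R ι) ∈
        ((piece R ι 1).baseChange S).map ((d r).baseChange S) := by
      rw [smul_comm]
      exact Submodule.smul_mem _ _ (hJle ha)
    exact h2

end Annihilator

end Koszul

theorem annihilator_subalgebra {k R M : Type*} [CommRing k] [CommRing R] [Algebra k R]
    [AddCommGroup M] [Module R M] (A : Subalgebra k R) :
    Module.annihilator A M = (Module.annihilator R M).comap A.val := by
  ext a
  rw [Ideal.mem_comap, Module.mem_annihilator, Module.mem_annihilator]
  rfl

/-! ### Multisets determined by elementary symmetric polynomials. -/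

section ElementarySymmetric

theorem Multiset.esymm_zero_cons {D : Type*} [CommRing D] (s : Multiset D) (k : ℕ) :
    (0 ::ₘ s).esymm k = s.esymm k := by
  cases k with
  | zero => simp [Multiset.esymm]
  | succ k =>
    simp [Multiset.esymm, Multiset.powersetCard_cons, Multiset.map_map]

theorem Multiset.esymm_filter_ne_zero {D : Type*} [CommRing D] [DecidableEq D]
    (s : Multiset D) (k : ℕ) : (s.filter (· ≠ 0)).esymm k = s.esymm k := by
  induction s using Multiset.induction_on generalizing k with
  | empty => simp
  | cons a s ih =>
    by_cases ha : a = 0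
    · subst ha
      simp [Multiset.esymm_zero_cons, ← ih k]
    · rw [Multiset.filter_cons_of_pos (p := (· ≠ 0)) _ ha]
      cases k with
      | zero => simp [Multiset.esymm]
      | succ k =>
        have h : ∀ t : Multiset D,
            (a ::ₘ t).esymm (k + 1) = t.esymm (k + 1) + a * t.esymm k := by
          intro t
          simp [Multiset.esymm, Multiset.powersetCard_cons, Multiset.map_map,
            Multiset.sum_map_mul_left]
        rw [h, h, ih, ih]

theorem Multiset.esymm_eq_zero_of_card_lt {D : Type*} [CommRing D] {s : Multiset D} {k : ℕ}
    (h : s.card < k) : s.esymm k = 0 := by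
  simp [Multiset.esymm, Multiset.powersetCard_eq_empty k h]

theorem Multiset.esymm_card {D : Type*} [CommRing D] (s : Multiset D) :
    s.esymm s.card = s.prod := by
  simp [Multiset.esymm]

theorem Multiset.eq_of_esymm_eq {D : Type*} [CommRing D] [IsDomain D] {s t : Multiset D}
    (hs : 0 ∉ s) (ht : 0 ∉ t) (h : ∀ k, s.esymm k = t.esymm k) : s = t := by
  have hle : ∀ {a b : Multiset D}, 0 ∉ a → (∀ k, a.esymm k = b.esymm k) →
      a.card ≤ b.card := by
    intro a b ha hab
    by_contra! hlt
    -- The top elementary symmetric polynomial is the product, nonzero in a domain; it would vanish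
    -- on the smaller multiset.
    have h1 := hab a.card
    rw [Multiset.esymm_card, Multiset.esymm_eq_zero_of_card_lt hlt] at h1
    exact ha (Multiset.prod_eq_zero_iff.mp h1)
  have hcard : s.card = t.card := le_antisymm (hle hs h) (hle ht fun k => (h k).symm)
  have hp : (s.map fun r => Polynomial.X - Polynomial.C r).prod =
      (t.map fun r => Polynomial.X - Polynomial.C r).prod := by
    rw [Multiset.prod_X_sub_X_eq_sum_esymm, Multiset.prod_X_sub_X_eq_sum_esymm, hcard]
    simp only [h]
  rw [← Polynomial.roots_multiset_prod_X_sub_C s, hp, Polynomial.roots_multiset_prod_X_sub_C]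

/-- Zeros do not affect elementary symmetric polynomials, and beyond the larger cardinality both
sides vanish, so the finitely many relations at a vertex carry all the information. -/
theorem Multiset.filter_ne_zero_eq_iff_esymm_eq {D : Type*} [CommRing D] [IsDomain D]
    [DecidableEq D] (s t : Multiset D) :
    (s.filter (· ≠ 0) = t.filter (· ≠ 0)) ↔
      ∀ i < max s.card t.card, s.esymm (i + 1) = t.esymm (i + 1) := by
  constructor
  · intro h i _
    rw [← Multiset.esymm_filter_ne_zero, h, Multiset.esymm_filter_ne_zero]
  · intro h
    refine Multiset.eq_of_esymm_eq (by simp) (by simp) fun k => ?_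
    rw [Multiset.esymm_filter_ne_zero, Multiset.esymm_filter_ne_zero]
    rcases k with _ | k
    · simp [Multiset.esymm]
    · by_cases hk : k < max s.card t.card
      · exact h k hk
      · rw [Multiset.esymm_eq_zero_of_card_lt (by omega),
          Multiset.esymm_eq_zero_of_card_lt (by omega)]

theorem RingHom.map_multiset_esymm {A B : Type*} [CommRing A] [CommRing B] (f : A →+* B)
    (s : Multiset A) (k : ℕ) : f (s.esymm k) = (s.map f).esymm k := by
  rw [Multiset.esymm, Multiset.esymm, map_multiset_sum, Multiset.powersetCard_map,
    Multiset.map_map, Multiset.map_map]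
  exact congrArg _ (Multiset.map_congr rfl fun t _ => map_multiset_prod f t)

end ElementarySymmetric

/-! ### Balanced labellings as points of the relation ideal. -/

namespace DirGraph

/-- A labelling of the edges is balanced if at every vertex each nonzero label occurs equally often
on the outgoing and on the incoming edges. -/
def Balanced {V E D : Type*} [Zero D] (G : DirGraph V E) (f : E → D) : Prop :=
  ∀ w, ∀ τ ≠ 0, {e | G.init e = w ∧ f e = τ}.ncard = {e | G.term e = w ∧ f e = τ}.ncard

theorem balanced_iff_relation_eq_zero {V E D : Type*} [Finite E] [CommRing D] [IsDomain D]
    (G : DirGraph V E) (f : MvPolynomial E ℤ →+* D) :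
    G.Balanced (fun e => f (.X e)) ↔ ∀ p, f (G.relation p) = 0 := by
  classical
  have hcount : ∀ (s : Finset E) (q : E → Prop) (_ : ∀ e, e ∈ s ↔ q e) (τ : D),
      (s.val.map fun e => f (.X e)).count τ = {e | q e ∧ f (.X e) = τ}.ncard := by
    intro s q hs τ
    rw [Multiset.count_map, ← Finset.filter_val, Finset.card_val, ← Set.ncard_coe_finset]
    congr 1
    ext e
    simp [← hs, eq_comm]
  have hout := fun w => hcount (G.outEdges w) (fun e => G.init e = w) (by simp [outEdges])
  have hin := fun w => hcount (G.inEdges w) (fun e => G.term e = w) (by simp [inEdges])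
  have hrel : (∀ p, f (G.relation p) = 0) ↔ ∀ w,
      ((G.outEdges w).val.map fun e => f (.X e)).filter (· ≠ 0) =
      ((G.inEdges w).val.map fun e => f (.X e)).filter (· ≠ 0) := by
    simp only [Multiset.filter_ne_zero_eq_iff_esymm_eq, Multiset.card_map]
    constructor
    · intro h w i hi
      have := h ⟨w, ⟨i, hi⟩⟩
      rw [relation, map_sub, RingHom.map_multiset_esymm, RingHom.map_multiset_esymm,
        Multiset.map_map, Multiset.map_map, sub_eq_zero] at this
      exact this
    · rintro h ⟨w, i, hi⟩
      rw [relation, map_sub, RingHom.map_multiset_esymm, RingHom.map_multiset_esymm,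
        Multiset.map_map, Multiset.map_map, sub_eq_zero]
      exact h w i hi
  rw [hrel]
  refine forall_congr' fun w => ?_
  simp only [Multiset.ext, Multiset.count_filter, ← hout, ← hin]
  exact forall_congr' fun τ => by by_cases h : τ = 0 <;> simp [h]

end DirGraph

/-! ### Two general bounds on Krull dimension. -/

section KrullDimension

theorem ringKrullDim_quotient_le_of_minimalPrimes {A : Type*} [CommRing A] (J : Ideal A)
    (N : WithBot ℕ∞) (h : ∀ q ∈ J.minimalPrimes, ringKrullDim (A ⧸ q) ≤ N) :
    ringKrullDim (A ⧸ J) ≤ N := by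
  rw [ringKrullDim_quotient]
  refine iSup_le fun p => ?_
  obtain ⟨q, hq, hqp⟩ := Ideal.exists_minimalPrimes_le (I := J) (J := p.head.1.asIdeal) p.head.2
  refine le_trans ?_ (h q hq)
  rw [ringKrullDim_quotient]
  have hmem : ∀ i, (p i).1 ∈ PrimeSpectrum.zeroLocus (q : Set A) := fun i =>
    show q ≤ (p i).1.asIdeal from hqp.trans (p.head_le i)
  exact le_iSup (fun s : LTSeries (PrimeSpectrum.zeroLocus (q : Set A)) =>
    (s.length : WithBot ℕ∞)) ⟨p.length, fun i => ⟨(p i).1, hmem i⟩, fun i => p.step i⟩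

/-- Incomparability: distinct comparable primes of an integral extension have distinct contractions.
-/
theorem ringKrullDim_le_of_isIntegral (A B : Type*) [CommRing A] [CommRing B] [Algebra A B]
    [Algebra.IsIntegral A B] : ringKrullDim B ≤ ringKrullDim A :=
  Order.krullDim_le_of_strictMono (PrimeSpectrum.comap (algebraMap A B)) fun P Q h =>
    Ideal.IsIntegral.comap_lt_comap (I := P.asIdeal) (J := Q.asIdeal) h

end KrullDimension

/-! ### Dimension and finiteness from generators. -/

section GeneratedAlgebra

open MvPolynomial

variable {k A : Type*} [CommRing k] [CommRing A] [Algebra k A]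

theorem MvPolynomial.aeval_surjective_of_adjoin_eq_top {ι τ : Type*} {x : ι → A}
    (hx : Algebra.adjoin k (Set.range x) = ⊤) {g : τ → A}
    (h : ∀ i, x i = 0 ∨ x i ∈ Set.range g) : Function.Surjective (aeval (R := k) g) := by
  rw [← AlgHom.range_eq_top, eq_top_iff, ← hx, ← Algebra.adjoin_range_eq_range_aeval,
    Algebra.adjoin_le_iff]
  rintro _ ⟨i, rfl⟩
  rcases h i with h0 | h1
  · rw [h0]
    exact zero_mem _
  · exact Algebra.subset_adjoin h1

theorem MvPolynomial.adjoin_range_of_surjective {ι : Type*} (f : MvPolynomial ι k →ₐ[k] A)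
    (hf : Function.Surjective f) : Algebra.adjoin k (Set.range fun i => f (X i)) = ⊤ := by
  have h := f.map_adjoin (Set.range X)
  rw [adjoin_range_X, Algebra.map_top, (AlgHom.range_eq_top _).mpr hf, ← Set.range_comp] at h
  exact h.symm

theorem Ideal.Quotient.adjoin_range_mk {ι : Type*} {x : ι → A}
    (hx : Algebra.adjoin k (Set.range x) = ⊤) (J : Ideal A) :
    Algebra.adjoin k (Set.range fun i => Ideal.Quotient.mk J (x i)) = ⊤ := by
  have h := (Ideal.Quotient.mkₐ k J).map_adjoin (Set.range x)
  rw [hx, Algebra.map_top, (AlgHom.range_eq_top _).mpr Ideal.Quotient.mk_surjective,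
    ← Set.range_comp] at h
  exact h.symm

/-- If a ring homomorphism takes at most `n` nonzero values on a generating family of a
`k`-algebra, then the quotient by its kernel has dimension at most `dim k + n`. -/
theorem ringKrullDim_quotient_ker_le_card [IsNoetherianRing k] {ι D : Type*} [CommRing D]
    {x : ι → A} (hx : Algebra.adjoin k (Set.range x) = ⊤) (f : A →+* D) (T : Finset D)
    (hT : ∀ i, f (x i) = 0 ∨ f (x i) ∈ T) :
    ringKrullDim (A ⧸ RingHom.ker f) ≤ ringKrullDim k + T.card := by
  classical
  -- One generator is chosen for each value in `T`; generators with the same value agree modulo the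
  -- kernel, so these choices suffice.
  let g : T → A ⧸ RingHom.ker f := fun t =>
    if h : ∃ i, f (x i) = t then Ideal.Quotient.mk _ (x h.choose) else 0
  have hsurj : Function.Surjective (aeval (R := k) g) := by
    refine aeval_surjective_of_adjoin_eq_top (Ideal.Quotient.adjoin_range_mk hx _) fun i => ?_
    refine (hT i).imp (fun h0 => Ideal.Quotient.eq_zero_iff_mem.mpr h0) fun h1 => ⟨⟨_, h1⟩, ?_⟩
    have h : ∃ j, f (x j) = f (x i) := ⟨i, rfl⟩
    simp only [g, dif_pos h]
    rw [Ideal.Quotient.eq, RingHom.mem_ker, map_sub, h.choose_spec, sub_self]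
  have := ringKrullDim_le_of_surjective (aeval (R := k) g).toRingHom hsurj
  rwa [ringKrullDim_of_isNoetherianRing, Nat.card_eq_fintype_card, Fintype.card_coe] at this

theorem le_ringKrullDim_quotient_of_mem_range [IsNoetherianRing k] {σ : Type*} [Finite σ]
    (f : A →ₐ[k] MvPolynomial σ k) (hf : ∀ s, X s ∈ f.range) (J : Ideal A)
    (hJ : ∀ a ∈ J, f a = 0) :
    ringKrullDim k + Nat.card σ ≤ ringKrullDim (A ⧸ J) := by
  have h : Function.Surjective f := by
    rw [← AlgHom.range_eq_top, eq_top_iff, ← adjoin_range_X, Algebra.adjoin_le_iff]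
    rintro _ ⟨s, rfl⟩
    exact hf s
  rw [← ringKrullDim_of_isNoetherianRing]
  exact ringKrullDim_le_of_surjective (Ideal.Quotient.lift J f.toRingHom hJ)
    (Ideal.Quotient.lift_surjective_of_surjective J hJ h)

/-- The generators become nilpotent, hence integral, and finitely many integral elements generate a
finite module. -/
theorem finite_quotient_of_mem_radical {ι : Type*} [Finite ι] {x : ι → A}
    (hx : Algebra.adjoin k (Set.range x) = ⊤) (J : Ideal A) (h : ∀ i, x i ∈ J.radical) :
    Module.Finite k (A ⧸ J) := by
  have hfin := fg_adjoin_of_finite (R := k)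
    (Set.finite_range fun i => Ideal.Quotient.mk J (x i)) (by
      rintro _ ⟨i, rfl⟩
      obtain ⟨n, hn⟩ := h i
      refine ⟨Polynomial.X ^ n, Polynomial.monic_X_pow n, ?_⟩
      rw [Polynomial.eval₂_X_pow, ← map_pow]
      exact Ideal.Quotient.eq_zero_iff_mem.mpr hn)
  rw [Ideal.Quotient.adjoin_range_mk hx] at hfin
  exact ⟨hfin⟩

end GeneratedAlgebra

/-! ### Contractions of ideals to a polynomial subring. -/

section PolynomialSubring

open MvPolynomial

variable {k A E : Type*} [CommRing k] [CommRing A] [Algebra k A] {S : Set E} {x : S → A}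
  {j : A →ₐ[k] MvPolynomial E k} {I : Ideal (MvPolynomial E k)} {J : Ideal A}

/-- Every minimal prime over a contracted ideal is the contraction of a prime `P` over `I`, so it is
enough to count the nonzero values of the variables from `S` modulo such `P`. -/
theorem ringKrullDim_quotient_comap_le [IsNoetherianRing k]
    (hx : Algebra.adjoin k (Set.range x) = ⊤) (hj : ∀ e, j (x e) = X (e : E))
    (hJ : ∀ a, a ∈ J ↔ j a ∈ I) (N : WithBot ℕ∞)
    (h : ∀ P : Ideal (MvPolynomial E k), P.IsPrime → I ≤ P →
      ∃ T : Finset (MvPolynomial E k ⧸ P),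
        (∀ e ∈ S, Ideal.Quotient.mk P (X e) = 0 ∨ Ideal.Quotient.mk P (X e) ∈ T) ∧
        ringKrullDim k + T.card ≤ N) :
    ringKrullDim (A ⧸ J) ≤ N := by
  obtain rfl : J = I.comap j.toRingHom := Ideal.ext hJ
  refine ringKrullDim_quotient_le_of_minimalPrimes _ N fun q hq => ?_
  obtain ⟨P, hP, hIP, rfl⟩ := Ideal.exists_comap_eq_of_mem_minimalPrimes j.toRingHom q hq
  obtain ⟨T, hT, hN⟩ := h P hP hIP
  refine le_trans ?_ hN
  have := ringKrullDim_quotient_ker_le_card hx ((Ideal.Quotient.mk P).comp j.toRingHom) T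
    fun e => by
      change Ideal.Quotient.mk P (j (x e)) = 0 ∨ Ideal.Quotient.mk P (j (x e)) ∈ T
      rw [hj]
      exact hT e e.2
  rwa [← RingHom.comap_ker, Ideal.mk_ker] at this

theorem le_ringKrullDim_quotient_comap [IsNoetherianRing k] (hj : ∀ e, j (x e) = X (e : E))
    (hJ : ∀ a, a ∈ J ↔ j a ∈ I) {σ : Type*} [Finite σ]
    (f : MvPolynomial E k →ₐ[k] MvPolynomial σ k) (hI : ∀ p ∈ I, f p = 0)
    (hσ : ∀ s, ∃ e ∈ S, f (X e) = X s) :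
    ringKrullDim k + Nat.card σ ≤ ringKrullDim (A ⧸ J) := by
  refine le_ringKrullDim_quotient_of_mem_range (f.comp j) (fun s => ?_) _
    fun a ha => hI _ ((hJ a).mp ha)
  obtain ⟨e, he, hes⟩ := hσ s
  exact ⟨x ⟨e, he⟩, (congrArg f (hj _)).trans hes⟩

theorem finite_quotient_comap [Finite E] (hx : Algebra.adjoin k (Set.range x) = ⊤)
    (hj : ∀ e, j (x e) = X (e : E)) (hJ : ∀ a, a ∈ J ↔ j a ∈ I) (h : ∀ e ∈ S, X e ∈ I.radical) :
    Module.Finite k (A ⧸ J) :=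
  finite_quotient_of_mem_radical hx _ fun e => by
    obtain ⟨n, hn⟩ := h e e.2
    refine ⟨n, ?_⟩
    rwa [hJ, map_pow, hj]

end PolynomialSubring

namespace MvPolynomial

variable {k E : Type*} [CommRing k] (S : Set E)

/-- The variable `X e` as an element of the subalgebra of polynomials in the variables from a set
that contains `e`. -/
noncomputable def supportedX (e : S) : supported k S :=
  ⟨X e, by rw [supported_eq_adjoin_X]; exact Algebra.subset_adjoin (Set.mem_image_of_mem X e.2)⟩

theorem adjoin_supportedX :
    Algebra.adjoin k (Set.range (supportedX (k := k) S)) = ⊤ := by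
  have h := adjoin_range_of_surjective (supportedEquivMvPolynomial (R := k) S).symm.toAlgHom
    (supportedEquivMvPolynomial S).symm.surjective
  have h2 : supportedX (k := k) S =
      fun e => (supportedEquivMvPolynomial (R := k) S).symm.toAlgHom (X e) :=
    _root_.funext fun e => Subtype.ext (supportedEquivMvPolynomial_symm_X (R := k) S e).symm
  rw [h2]
  exact h

end MvPolynomial

namespace DirGraph

/-! ### Directed paths and reachability. -/

section Paths

variable {V E : Type*} {G : DirGraph V E} {u v : V}

theorem DirPath.vert_castSucc_ne (P : G.DirPath u v) (i : Fin P.length) :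
    P.vert i.castSucc ≠ v := fun h =>
  (Fin.castSucc_lt_last i).ne (P.vert_injective (h.trans P.vert_last.symm))

theorem DirPath.vert_succ_ne (P : G.DirPath u v) (i : Fin P.length) : P.vert i.succ ≠ u :=
  fun h => Fin.succ_ne_zero i (P.vert_injective (h.trans P.vert_zero.symm))

theorem DirPath.edge_injective (P : G.DirPath u v) : Function.Injective P.edge := fun i j h =>
  Fin.castSucc_injective _ (P.vert_injective (by rw [← P.init_edge, h, P.init_edge]))

theorem DirPath.length_pos (huv : u ≠ v) (P : G.DirPath u v) : 0 < P.length := by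
  refine Nat.pos_of_ne_zero fun h => huv ?_
  refine P.vert_zero.symm.trans ((congrArg P.vert ?_).trans P.vert_last)
  ext
  simp [h]

theorem DirPath.notMem_badEdges (P : G.DirPath u v) (i : Fin P.length) :
    P.edge i ∉ G.badEdges u v := by
  rintro (h | h)
  · exact P.vert_succ_ne i ((P.term_edge i).symm.trans h)
  · exact P.vert_castSucc_ne i ((P.init_edge i).symm.trans h)

/-- The part of a directed path up to one of its vertices. -/
def DirPath.take (P : G.DirPath u v) (i : Fin (P.length + 1)) : G.DirPath u (P.vert i) where
  length := i
  vert j := P.vert (Fin.castLE i.2 j)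
  edge j := P.edge (Fin.castLE (Nat.lt_succ_iff.mp i.2) j)
  vert_injective := P.vert_injective.comp (Fin.castLE_injective _)
  vert_zero := P.vert_zero
  vert_last := rfl
  init_edge _ := P.init_edge _
  term_edge _ := P.term_edge _

/-- A directed path extended by an edge to a new vertex. -/
def DirPath.snoc (P : G.DirPath u v) (e : E) (he : G.init e = v)
    (hnew : ∀ i, P.vert i ≠ G.term e) : G.DirPath u (G.term e) where
  length := P.length + 1
  vert := Fin.snoc (α := fun _ => V) P.vert (G.term e)
  edge := Fin.snoc (α := fun _ => E) P.edge e
  vert_injective := by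
    rw [Fin.snoc_injective_iff]
    exact ⟨P.vert_injective, fun ⟨i, hi⟩ => hnew i hi⟩
  vert_zero := by
    have h := Fin.snoc_castSucc (α := fun _ => V) (G.term e) P.vert 0
    rw [Fin.castSucc_zero] at h
    exact h.trans P.vert_zero
  vert_last := Fin.snoc_last (α := fun _ => V) _ _
  init_edge i := by
    induction i using Fin.lastCases with
    | last => simpa using he.trans P.vert_last.symm
    | cast i => simpa using P.init_edge i
  term_edge i := by
    induction i using Fin.lastCases with
    | last => simp
    | cast i =>
      rw [Fin.succ_castSucc, Fin.snoc_castSucc, Fin.snoc_castSucc]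
      exact P.term_edge i

/-- A walk becomes a path by cutting back to the earlier visit whenever the next edge returns to a
vertex already used. -/
theorem nonempty_dirPath_of_reflTransGen
    (h : Relation.ReflTransGen (fun a b => ∃ e, G.init e = a ∧ G.term e = b) u v) :
    Nonempty (G.DirPath u v) := by
  induction h with
  | refl =>
    exact ⟨{ length := 0
             vert := fun _ => u
             edge := Fin.elim0
             vert_injective := fun i j _ => Subsingleton.elim (α := Fin 1) i j
             vert_zero := rfl
             vert_last := rfl
             init_edge := fun i => i.elim0
             term_edge := fun i => i.elim0 }⟩
  | tail _ hbc ih =>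
    obtain ⟨P⟩ := ih
    obtain ⟨e, he, rfl⟩ := hbc
    by_cases hnew : ∃ i, P.vert i = G.term e
    · obtain ⟨i, hi⟩ := hnew
      exact ⟨hi ▸ P.take i⟩
    · push Not at hnew
      exact ⟨P.snoc e he hnew⟩

theorem deleteEdges_incident_isEmpty_dirPath (huv : u ≠ v) {S : Set E} (hS : G.incident u ⊆ S) :
    IsEmpty ((G.deleteEdges S).DirPath u v) := by
  refine ⟨fun P => (P.edge ⟨0, P.length_pos huv⟩).2 (hS (Or.inl ?_))⟩
  exact (P.init_edge ⟨0, P.length_pos huv⟩).trans P.vert_zero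

theorem isEmpty_deleteEdges_dirPath {S : Set E} (h : IsEmpty (G.DirPath u v)) :
    IsEmpty ((G.deleteEdges S).DirPath u v) :=
  ⟨fun P => h.elim
    { length := P.length
      vert := P.vert
      edge := fun i => P.edge i
      vert_injective := P.vert_injective
      vert_zero := P.vert_zero
      vert_last := P.vert_last
      init_edge := P.init_edge
      term_edge := P.term_edge }⟩

end Paths

/-! ### Flows in the glued graph. -/

section Gluing

variable {V E : Type*} {u v : V}

theorem Glued.mk_eq_mk_iff {a b : V} :
    (Quot.mk _ a : Glued u v) = Quot.mk _ b ↔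
      a = b ∨ (a = u ∨ a = v) ∧ (b = u ∨ b = v) := by
  classical
  have huv : (Quot.mk _ u : Glued u v) = Quot.mk _ v := Quot.sound ⟨rfl, rfl⟩
  constructor
  · intro h
    have h2 := congrArg (Quot.lift (fun a => if a = v then u else a)
      (by rintro a b ⟨rfl, rfl⟩; simp)) h
    change (if a = v then u else a) = if b = v then u else b at h2
    grind
  · rintro (rfl | ⟨rfl | rfl, rfl | rfl⟩)
    · rfl
    · rfl
    · exact huv
    · exact huv.symm
    · rfl

theorem mk_eq_gluedVertex_iff {a : V} :
    (Quot.mk _ a : Glued u v) = gluedVertex u v ↔ a = u ∨ a = v := by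
  rw [gluedVertex, Glued.mk_eq_mk_iff]
  tauto

variable (G : DirGraph V E)

theorem mem_gluedEdges_iff (e : {e : E // e ∉ G.badEdges u v}) :
    e ∈ G.gluedEdges u v ↔ G.init e = u ∨ G.term e = v := by
  have h1 : G.term e ≠ u := fun h => e.2 (Or.inl h)
  have h2 : G.init e ≠ v := fun h => e.2 (Or.inr h)
  change (Quot.mk _ (G.init e) : Glued u v) = _ ∨ (Quot.mk _ (G.term e) : Glued u v) = _ ↔ _
  rw [mk_eq_gluedVertex_iff, mk_eq_gluedVertex_iff]
  tauto

/-- In a balanced labelling of `G_{u → v}`, every nonzero label of an edge at `u # v` occurs in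
every set of edges whose removal destroys all directed paths from `u` to `v`. -/
theorem exists_mem_of_balanced [Finite V] [Finite E] {D : Type*} [Zero D]
    {f : {e : E // e ∉ G.badEdges u v} → D} (hf : (G.pathGraph u v).Balanced f) {S : Set E}
    (hS : IsEmpty ((G.deleteEdges S).DirPath u v)) {e : {e : E // e ∉ G.badEdges u v}}
    (he : e ∈ G.gluedEdges u v) (h0 : f e ≠ 0) :
    ∃ e' : {e : E // e ∉ G.badEdges u v}, (e' : E) ∈ S ∧ f e' = f e := by
  classical
  by_contra! hno
  have := Fintype.ofFinite V
  have := Fintype.ofFinite E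
  set τ := f e with hτ
  let E' := {e : E // e ∉ G.badEdges u v}
  have hterm : ∀ e : E', G.term e ≠ u := fun e h => e.2 (Or.inl h)
  have hinit : ∀ e : E', G.init e ≠ v := fun e h => e.2 (Or.inr h)
  let r : V → V → Prop := fun a b => ∃ e : E', f e = τ ∧ G.init e = a ∧ G.term e = b
  -- The vertices reachable from `u` along edges labelled `τ`. If `S` carried no label `τ`, such
  -- edges would survive its removal, so `v` would not be reachable.
  let W : Finset V := Finset.univ.filter (Relation.ReflTransGen r u)
  have hWu : u ∈ W := by simp [W, Relation.ReflTransGen.refl]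
  have hWv : v ∉ W := by
    intro h
    simp only [W, Finset.mem_filter, Finset.mem_univ, true_and] at h
    refine not_isEmpty_iff.mpr (nonempty_dirPath_of_reflTransGen
      (Relation.ReflTransGen.mono ?_ _ _ h)) hS
    rintro a b ⟨e', he', ha, hb⟩
    exact ⟨⟨e', fun hmem => hno e' hmem he'⟩, ha, hb⟩
  let out : V → ℕ := fun w => (Finset.univ.filter fun e : E' => f e = τ ∧ G.init e = w).card
  let inn : V → ℕ := fun w => (Finset.univ.filter fun e : E' => f e = τ ∧ G.term e = w).card
  have hbal : ∀ w : V,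
      (Finset.univ.filter fun e : E' =>
        f e = τ ∧ (Quot.mk _ (G.init e) : Glued u v) = Quot.mk _ w).card =
      (Finset.univ.filter fun e : E' =>
        f e = τ ∧ (Quot.mk _ (G.term e) : Glued u v) = Quot.mk _ w).card := by
    intro w
    have h := hf (Quot.mk _ w) τ h0
    rw [Set.ncard_eq_toFinset_card', Set.ncard_eq_toFinset_card'] at h
    convert h using 2 <;> ext e <;> simp [pathGraph, identify, deleteEdges, and_comm]
  have hother : ∀ w, w ≠ u → w ≠ v → out w = inn w := by
    intro w hu hv
    have h := hbal w
    simpa only [Glued.mk_eq_mk_iff, hu, hv, or_self, and_false, or_false] using h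
  -- Balance at `u # v`: since the edges into `u` and out of `v` are gone, the edges leaving it
  -- start at `u` and those entering it end at `v`.
  have huv : out u = inn v := by
    have h := hbal u
    change _ = (Finset.univ.filter fun e : E' => f e = τ ∧ _ = gluedVertex u v).card at h
    change (Finset.univ.filter fun e : E' => f e = τ ∧ _ = gluedVertex u v).card = _ at h
    simpa only [mk_eq_gluedVertex_iff, hterm, hinit, or_false, false_or] using h
  have hpos : 0 < out u := by
    rcases (G.mem_gluedEdges_iff e).mp he with h | h
    · exact Finset.card_pos.mpr ⟨e, by simp [h, hτ]⟩
    · rw [huv]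
      exact Finset.card_pos.mpr ⟨e, by simp [h, hτ]⟩
  have hinu : inn u = 0 := by simp [inn, hterm]
  have hlt : ∑ w ∈ W, inn w < ∑ w ∈ W, out w := by
    refine Finset.sum_lt_sum (fun w hw => ?_) ⟨u, hWu, hinu ▸ hpos⟩
    by_cases hu : w = u
    · subst hu
      rw [hinu]
      exact Nat.zero_le _
    · exact (hother w hu fun h => hWv (h ▸ hw)).ge
  have hsum : ∀ g : E' → V,
      ∑ w ∈ W, (Finset.univ.filter fun e : E' => f e = τ ∧ g e = w).card =
        (Finset.univ.filter fun e : E' => f e = τ ∧ g e ∈ W).card := by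
    intro g
    rw [Finset.card_eq_sum_card_fiberwise (f := g) (t := W) fun e he => (Finset.mem_filter.mp he).2.2]
    refine Finset.sum_congr rfl fun w hw => ?_
    rw [Finset.filter_filter]
    congr 1
    ext e
    simp only [Finset.mem_filter, Finset.mem_univ, true_and]
    exact ⟨fun h => ⟨⟨h.1, h.2 ▸ hw⟩, h.2⟩, fun h => ⟨h.1.1, h.2⟩⟩
  -- An edge labelled `τ` that starts in `W` also ends in `W`, so the outflow of `W` cannot exceed
  -- its inflow.
  refine hlt.not_ge ((hsum fun e => G.init e).trans_le
    (le_trans (Finset.card_le_card fun e he => ?_) (hsum fun e => G.term e).ge))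
  simp only [W, Finset.mem_filter, Finset.mem_univ, true_and] at he ⊢
  exact ⟨he.1, he.2.tail ⟨e, he.1, rfl, rfl⟩⟩

theorem _root_.Fin.ncard_castSucc_eq_ncard_succ {n : ℕ} (q : Fin (n + 1) → Prop)
    (h : q 0 ↔ q (Fin.last n)) :
    {j : Fin n | q j.castSucc}.ncard = {j : Fin n | q j.succ}.ncard := by
  classical
  rw [Set.ncard_eq_toFinset_card', Set.ncard_eq_toFinset_card', Set.toFinset_ofPred,
    Set.toFinset_ofPred, Finset.card_filter, Finset.card_filter]
  have h1 := Fin.sum_univ_castSucc fun j => if q j then 1 else 0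
  rw [Fin.sum_univ_succ] at h1
  simp only [h] at h1
  omega

/-- Edge-disjoint directed paths from `u` to `v` give a labelling of the edges of `G_{u → v}` by
the paths, which is balanced. -/
theorem exists_label_of_disjoint_dirPaths (huv : u ≠ v) {σ : Type*} (P : σ → G.DirPath u v)
    (hP : Pairwise fun i j => Disjoint (P i).edgeSet (P j).edgeSet) :
    ∃ label : {e : E // e ∉ G.badEdges u v} → Option σ,
      (∀ w s, {e | (G.pathGraph u v).init e = w ∧ label e = some s}.ncard =
        {e | (G.pathGraph u v).term e = w ∧ label e = some s}.ncard) ∧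
      ∀ s, ∃ e ∈ G.gluedEdges u v, label e = some s := by
  classical
  let label : {e : E // e ∉ G.badEdges u v} → Option σ := fun e =>
    if h : ∃ s, (e : E) ∈ (P s).edgeSet then some h.choose else none
  have hlabel : ∀ e s, label e = some s ↔ (e : E) ∈ (P s).edgeSet := by
    intro e s
    have huniq : ∀ s t, (e : E) ∈ (P s).edgeSet → (e : E) ∈ (P t).edgeSet → s = t := by
      intro s t hs ht
      by_contra hne
      exact Set.disjoint_left.mp (hP hne) hs ht
    simp only [label]
    split_ifs with h
    · rw [Option.some_inj]
      exact ⟨fun hs => hs ▸ h.choose_spec, fun hs => huniq _ _ h.choose_spec hs⟩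
    · simp only [false_iff]
      exact fun hs => h ⟨s, hs⟩
  refine ⟨label, fun w s => ?_, fun s => ?_⟩
  · let g : Fin (P s).length → {e : E // e ∉ G.badEdges u v} := fun j =>
      ⟨(P s).edge j, (P s).notMem_badEdges j⟩
    have hg : Function.Injective g := fun i j h =>
      (P s).edge_injective (congrArg Subtype.val h)
    have himage : ∀ F : {e : E // e ∉ G.badEdges u v} → Glued u v,
        {e | F e = w ∧ label e = some s} = g '' {j | F (g j) = w} := by
      intro F
      ext e
      simp only [hlabel, Set.mem_ofPred_eq, Set.mem_image]
      constructor
      · rintro ⟨hF, j, hj⟩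
        obtain rfl : g j = e := Subtype.ext hj
        exact ⟨j, hF, rfl⟩
      · rintro ⟨j, hF, rfl⟩
        exact ⟨hF, j, rfl⟩
    rw [himage, himage, Set.ncard_image_of_injective _ hg, Set.ncard_image_of_injective _ hg]
    have h := Fin.ncard_castSucc_eq_ncard_succ
      (fun i => (Quot.mk _ ((P s).vert i) : Glued u v) = w) (by
        rw [(P s).vert_zero, (P s).vert_last, (Quot.sound ⟨rfl, rfl⟩ :
          (Quot.mk _ u : Glued u v) = Quot.mk _ v)])
    simp only [← (P s).init_edge, ← (P s).term_edge] at h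
    exact h
  · refine ⟨⟨_, (P s).notMem_badEdges ⟨0, (P s).length_pos huv⟩⟩, ?_, (hlabel _ _).mpr ⟨_, rfl⟩⟩
    rw [mem_gluedEdges_iff]
    exact Or.inl (((P s).init_edge _).trans (P s).vert_zero)

end Gluing

end DirGraph

namespace DirGraph

/-! ### The relation ideal over a general coefficient ring. -/

section RelationIdeal

open MvPolynomial

variable {V E : Type*} [Finite E] (k : Type*) [CommRing k] (G : DirGraph V E)

/-- The ideal of `k[E]` generated by the incidence relations. -/
noncomputable def relationIdeal : Ideal (MvPolynomial E k) :=
  Ideal.span (Set.range fun p => map (Int.castRingHom k) (G.relation p))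

theorem relationIdeal_int : G.relationIdeal ℤ = Ideal.span (Set.range G.relation) := by
  have h : Int.castRingHom ℤ = RingHom.id ℤ := Subsingleton.elim _ _
  simp only [relationIdeal, h, map_id]

variable {k} {G}

theorem balanced_iff_map_relationIdeal_eq_zero {D : Type*} [CommRing D] [IsDomain D]
    (f : MvPolynomial E k →+* D) :
    G.Balanced (fun e => f (X e)) ↔ ∀ p ∈ G.relationIdeal k, f p = 0 := by
  have h := G.balanced_iff_relation_eq_zero (f.comp (map (Int.castRingHom k)))
  simp only [RingHom.comp_apply, map_X] at h
  rw [h]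
  change _ ↔ G.relationIdeal k ≤ RingHom.ker f
  rw [relationIdeal, Ideal.span_le, Set.range_subset_iff]
  rfl

theorem balanced_quotient_of_relationIdeal_le {P : Ideal (MvPolynomial E k)} [P.IsPrime]
    (hP : G.relationIdeal k ≤ P) : G.Balanced fun e => Ideal.Quotient.mk P (X e) :=
  (balanced_iff_map_relationIdeal_eq_zero (Ideal.Quotient.mk P)).mpr fun _ hp =>
    Ideal.Quotient.eq_zero_iff_mem.mpr (hP hp)

theorem aeval_eq_zero_of_mem_relationIdeal [IsDomain k] {σ : Type*} {label : E → Option σ}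
    (h : ∀ w s, {e | G.init e = w ∧ label e = some s}.ncard =
      {e | G.term e = w ∧ label e = some s}.ncard) {p : MvPolynomial E k}
    (hp : p ∈ G.relationIdeal k) :
    aeval (fun e => (label e).elim (0 : MvPolynomial σ k) X) p = 0 := by
  let f : MvPolynomial E k →ₐ[k] MvPolynomial σ k := aeval fun e => (label e).elim 0 X
  refine (balanced_iff_map_relationIdeal_eq_zero f.toRingHom).mp (fun w τ hτ => ?_) p hp
  have hf : ∀ e, f.toRingHom (X e) = (label e).elim (0 : MvPolynomial σ k) X := fun e =>
    aeval_X _ _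
  simp only [hf]
  by_cases hs : ∃ s, (X s : MvPolynomial σ k) = τ
  · obtain ⟨s, rfl⟩ := hs
    have hiff : ∀ e, (label e).elim (0 : MvPolynomial σ k) X = X s ↔ label e = some s := by
      intro e
      cases label e with
      | none => simpa using (X_ne_zero s).symm
      | some t => simp [X_inj]
    simpa only [hiff] using h w s
  · have hne : ∀ e, (label e).elim (0 : MvPolynomial σ k) X ≠ τ := by
      intro e
      cases label e with
      | none => exact hτ.symm
      | some t => exact fun ht => hs ⟨t, ht⟩
    simp [hne]

end RelationIdeal

/-! ### Dimension bounds from paths, cuts and change of coefficients. -/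

section PathGraph

open MvPolynomial

variable {V E : Type*} [Finite E] {G : DirGraph V E} {u v : V}
  {k A : Type*} [CommRing k] [CommRing A] [Algebra k A]
  {x : G.gluedEdges u v → A} {j : A →ₐ[k] MvPolynomial {e : E // e ∉ G.badEdges u v} k}
  {J : Ideal A}

theorem le_ringKrullDim_of_label [IsDomain k] [IsNoetherianRing k]
    (hj : ∀ e, j (x e) = X (e : {e : E // e ∉ G.badEdges u v}))
    (hJ : ∀ a, a ∈ J ↔ j a ∈ (G.pathGraph u v).relationIdeal k) {σ : Type*} [Finite σ]
    {label : {e : E // e ∉ G.badEdges u v} → Option σ}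
    (h : ∀ w s, {e | (G.pathGraph u v).init e = w ∧ label e = some s}.ncard =
        {e | (G.pathGraph u v).term e = w ∧ label e = some s}.ncard)
    (hσ : ∀ s, ∃ e ∈ G.gluedEdges u v, label e = some s) :
    ringKrullDim k + Nat.card σ ≤ ringKrullDim (A ⧸ J) := by
  refine le_ringKrullDim_quotient_comap hj hJ (aeval fun e => (label e).elim 0 X)
    (fun p hp => aeval_eq_zero_of_mem_relationIdeal h hp) fun s => ?_
  obtain ⟨e, he, hes⟩ := hσ s
  exact ⟨e, he, by rw [aeval_X, hes]; rfl⟩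

theorem ringKrullDim_le_ringKrullDim_quotient [IsDomain k] [IsNoetherianRing k]
    (hj : ∀ e, j (x e) = X (e : {e : E // e ∉ G.badEdges u v}))
    (hJ : ∀ a, a ∈ J ↔ j a ∈ (G.pathGraph u v).relationIdeal k) :
    ringKrullDim k ≤ ringKrullDim (A ⧸ J) := by
  -- The zero labelling is balanced and maps the quotient onto `k` itself.
  have h := le_ringKrullDim_of_label hj hJ (σ := Fin 0) (label := fun _ => none)
    (fun _ s => s.elim0) (fun s => s.elim0)
  simpa using h

theorem ringKrullDim_add_le_of_disjoint_dirPaths [IsDomain k] [IsNoetherianRing k] (huv : u ≠ v)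
    (hj : ∀ e, j (x e) = X (e : {e : E // e ∉ G.badEdges u v}))
    (hJ : ∀ a, a ∈ J ↔ j a ∈ (G.pathGraph u v).relationIdeal k) {n : ℕ}
    (P : Fin n → G.DirPath u v)
    (hP : Pairwise fun i j => Disjoint (P i).edgeSet (P j).edgeSet) :
    ringKrullDim k + n ≤ ringKrullDim (A ⧸ J) := by
  obtain ⟨label, h, hσ⟩ := G.exists_label_of_disjoint_dirPaths huv P hP
  simpa using le_ringKrullDim_of_label hj hJ h hσ

theorem ringKrullDim_le_of_cut [Finite V] [IsNoetherianRing k]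
    (hx : Algebra.adjoin k (Set.range x) = ⊤)
    (hj : ∀ e, j (x e) = X (e : {e : E // e ∉ G.badEdges u v}))
    (hJ : ∀ a, a ∈ J ↔ j a ∈ (G.pathGraph u v).relationIdeal k) (S : Finset E)
    (hS : IsEmpty ((G.deleteEdges (S : Set E)).DirPath u v)) :
    ringKrullDim (A ⧸ J) ≤ ringKrullDim k + S.card := by
  classical
  refine ringKrullDim_quotient_comap_le hx hj hJ _ fun P hP hIP =>
    ⟨(S.subtype (· ∉ G.badEdges u v)).image fun e => Ideal.Quotient.mk P (X e),
      fun e he => ?_, ?_⟩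
  · refine or_iff_not_imp_left.mpr fun h0 => ?_
    obtain ⟨e', he', hee⟩ := G.exists_mem_of_balanced
      (balanced_quotient_of_relationIdeal_le hIP) hS he h0
    exact Finset.mem_image.mpr ⟨e', Finset.mem_subtype.mpr he', hee⟩
  · gcongr
    refine Finset.card_image_le.trans ?_
    rw [Finset.card_subtype]
    exact Finset.card_filter_le _ _

/-- A nonzero label at `u # v` would have to occur on the empty cut, so those variables lie in every
prime over the relation ideal, that is, in its radical. -/
theorem finite_of_isEmpty_dirPath [Finite V] (hx : Algebra.adjoin k (Set.range x) = ⊤)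
    (hj : ∀ e, j (x e) = X (e : {e : E // e ∉ G.badEdges u v}))
    (hJ : ∀ a, a ∈ J ↔ j a ∈ (G.pathGraph u v).relationIdeal k)
    (h : IsEmpty (G.DirPath u v)) : Module.Finite k (A ⧸ J) := by
  refine finite_quotient_comap hx hj hJ fun e he => ?_
  rw [Ideal.radical_eq_sInf, Ideal.mem_sInf]
  rintro P ⟨hIP, hP⟩
  by_contra h0
  rw [← Ideal.Quotient.eq_zero_iff_mem] at h0
  obtain ⟨e', he', -⟩ := G.exists_mem_of_balanced (S := ∅)
    (balanced_quotient_of_relationIdeal_le hIP) (isEmpty_deleteEdges_dirPath h) he h0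
  exact he'

theorem _root_.WithBot.exists_eq_natCast_add_one {d : WithBot ℕ∞} {n : ℕ} (h1 : 1 ≤ d) (hn : d ≤ n) :
    ∃ m : ℕ, d = m + 1 := by
  induction d using WithBot.recBotCoe with
  | bot => simp at h1
  | coe d =>
    induction d using ENat.recTopCoe with
    | top => exact absurd hn (by exact_mod_cast (ENat.natCast_lt_top n).not_ge)
    | coe d =>
      obtain ⟨m, rfl⟩ := Nat.exists_eq_add_of_le' (show 1 ≤ d by exact_mod_cast h1)
      exact ⟨m, by push_cast; rfl⟩

/-- The labelling of the edges by the values of the variables modulo a prime ideal of `ℚ[E]` shows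
that the dimension over `ℚ` is smaller than that over `ℤ`. -/
theorem ringKrullDim_rat_add_one_le {A B : Type*} [CommRing A] [CommRing B] [Algebra ℤ A]
    [Algebra ℚ B] {x : G.gluedEdges u v → A} {y : G.gluedEdges u v → B}
    {i : A →ₐ[ℤ] MvPolynomial {e : E // e ∉ G.badEdges u v} ℤ}
    {j : B →ₐ[ℚ] MvPolynomial {e : E // e ∉ G.badEdges u v} ℚ} {I : Ideal A} {J : Ideal B}
    (hi : ∀ e, i (x e) = X (e : {e : E // e ∉ G.badEdges u v}))
    (hI : ∀ a, a ∈ I ↔ i a ∈ (G.pathGraph u v).relationIdeal ℤ)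
    (hy : Algebra.adjoin ℚ (Set.range y) = ⊤)
    (hj : ∀ e, j (y e) = X (e : {e : E // e ∉ G.badEdges u v}))
    (hJ : ∀ a, a ∈ J ↔ j a ∈ (G.pathGraph u v).relationIdeal ℚ)
    {n : ℕ} (hn : ringKrullDim (A ⧸ I) ≤ n) :
    ringKrullDim (B ⧸ J) + 1 ≤ ringKrullDim (A ⧸ I) := by
  classical
  have := Fintype.ofFinite E
  have hZ : ringKrullDim ℤ = 1 :=
    IsPrincipalIdealRing.ringKrullDim_eq_one ℤ Int.not_isField
  obtain ⟨m, hm⟩ := WithBot.exists_eq_natCast_add_one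
    (hZ ▸ ringKrullDim_le_ringKrullDim_quotient hi hI) hn
  rw [hm]
  gcongr
  refine ringKrullDim_quotient_comap_le hy hj hJ _ fun P hP hIP => ?_
  let f : {e : E // e ∉ G.badEdges u v} → MvPolynomial {e : E // e ∉ G.badEdges u v} ℚ ⧸ P :=
    fun e => Ideal.Quotient.mk P (X e)
  have hf : (G.pathGraph u v).Balanced f := balanced_quotient_of_relationIdeal_le hIP
  -- The distinct nonzero values at `u # v` bound the dimension over `ℚ` from above; as names of
  -- independent variables over `ℤ` they give a quotient of dimension `T.card + 1`.
  let T := (Finset.univ.filter fun e => e ∈ G.gluedEdges u v ∧ f e ≠ 0).image f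
  have hT : ∀ τ ∈ T, τ ≠ 0 ∧ ∃ e ∈ G.gluedEdges u v, f e = τ := by
    intro τ hτ
    obtain ⟨e, he, rfl⟩ := Finset.mem_image.mp hτ
    simp only [Finset.mem_filter, Finset.mem_univ, true_and] at he
    exact ⟨he.2, e, he.1, rfl⟩
  refine ⟨T, fun e he => or_iff_not_imp_left.mpr fun h0 => Finset.mem_image.mpr
    ⟨e, by simpa using ⟨he, h0⟩, rfl⟩, ?_⟩
  let label : {e : E // e ∉ G.badEdges u v} → Option T := fun e =>
    if h : f e ∈ T then some ⟨f e, h⟩ else none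
  have hlabel : ∀ e (t : T), label e = some t ↔ f e = t := by
    intro e t
    simp only [label]
    split_ifs with h
    · rw [Option.some_inj, Subtype.ext_iff]
    · simp only [false_iff]
      exact fun he => h (he ▸ t.2)
  have h := le_ringKrullDim_of_label hi hI (σ := T) (label := label)
    (fun w t => by
      simp only [hlabel]
      exact hf w t (hT t t.2).1)
    (fun t => by
      obtain ⟨e, he, het⟩ := (hT t t.2).2
      exact ⟨e, he, (hlabel e t).mpr het⟩)
  rw [hm, hZ, Nat.card_eq_fintype_card, Fintype.card_coe, add_comm] at h
  rw [ringKrullDim_eq_zero_of_field, zero_add]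
  have h2 : T.card + 1 ≤ m + 1 := by exact_mod_cast h
  exact_mod_cast Nat.le_of_succ_le_succ h2

theorem alphaPath_le [IsNoetherianRing k] [IsDomain k] (huv : u ≠ v)
    (hj : ∀ e, j (x e) = X (e : {e : E // e ∉ G.badEdges u v}))
    (hJ : ∀ a, a ∈ J ↔ j a ∈ (G.pathGraph u v).relationIdeal k) {n : ℕ}
    (hk : ringKrullDim k = 0) (hn : ringKrullDim (A ⧸ J) ≤ n) :
    G.alphaPath u v ≤ ringKrullDim (A ⧸ J) := by
  have hpaths : ∀ m ∈ {m | ∃ P : Fin m → G.DirPath u v,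
      Pairwise fun i j => Disjoint (P i).edgeSet (P j).edgeSet},
      (m : WithBot ℕ∞) ≤ ringKrullDim (A ⧸ J) := by
    rintro m ⟨P, hP⟩
    have h := ringKrullDim_add_le_of_disjoint_dirPaths huv hj hJ P hP
    rwa [hk, zero_add] at h
  -- The finite upper bound `n` on the dimension bounds the sizes of path families, so the supremum
  -- is attained.
  refine hpaths _ (Nat.sSup_mem ⟨0, Fin.elim0, fun i => i.elim0⟩ ⟨n, fun m hm => ?_⟩)
  exact_mod_cast (hpaths m hm).trans hn

theorem ringKrullDim_le_betaPath [Finite V] [IsNoetherianRing k] (huv : u ≠ v)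
    (hx : Algebra.adjoin k (Set.range x) = ⊤)
    (hj : ∀ e, j (x e) = X (e : {e : E // e ∉ G.badEdges u v}))
    (hJ : ∀ a, a ∈ J ↔ j a ∈ (G.pathGraph u v).relationIdeal k) :
    ringKrullDim (A ⧸ J) ≤ ringKrullDim k + G.betaPath u v := by
  have hne : {m | ∃ S : Finset E, (S : Set E) ⊆ G.incident u ∪ G.incident v ∧
      IsEmpty ((G.deleteEdges (S : Set E)).DirPath u v) ∧ S.card = m}.Nonempty := by
    -- Removing all edges at `u` is an admissible cut, so the infimum is attained and not the
    -- default value 0.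
    refine ⟨_, (Set.toFinite (G.incident u)).toFinset, ?_, ?_, rfl⟩
    · rw [Set.Finite.coe_toFinset]
      exact Set.subset_union_left
    · exact deleteEdges_incident_isEmpty_dirPath huv (Set.Finite.coe_toFinset _).ge
  obtain ⟨C, -, hC, hcard⟩ := Nat.sInf_mem hne
  rw [betaPath, ← hcard]
  exact ringKrullDim_le_of_cut hx hj hJ C hC

theorem tfae_and_ringKrullDim_bounds [Finite V] (huv : u ≠ v) {A B : Type*} [CommRing A]
    [CommRing B] [Algebra ℤ A] [Algebra ℚ B] {x : G.gluedEdges u v → A} {y : G.gluedEdges u v → B}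
    {i : A →ₐ[ℤ] MvPolynomial {e : E // e ∉ G.badEdges u v} ℤ}
    {j : B →ₐ[ℚ] MvPolynomial {e : E // e ∉ G.badEdges u v} ℚ} {I : Ideal A} {J : Ideal B}
    (hx : Algebra.adjoin ℤ (Set.range x) = ⊤)
    (hi : ∀ e, i (x e) = X (e : {e : E // e ∉ G.badEdges u v}))
    (hI : ∀ a, a ∈ I ↔ i a ∈ (G.pathGraph u v).relationIdeal ℤ)
    (hy : Algebra.adjoin ℚ (Set.range y) = ⊤)
    (hj : ∀ e, j (y e) = X (e : {e : E // e ∉ G.badEdges u v}))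
    (hJ : ∀ a, a ∈ J ↔ j a ∈ (G.pathGraph u v).relationIdeal ℚ)
    [m : Module ℤ (A ⧸ I)] :
    [IsEmpty (G.DirPath u v), Module.Finite ℤ (A ⧸ I), ringKrullDim (A ⧸ I) = 1,
      ringKrullDim (B ⧸ J) = 0].TFAE ∧
    G.alphaPath u v ≤ ringKrullDim (B ⧸ J) ∧
    ringKrullDim (B ⧸ J) + 1 ≤ ringKrullDim (A ⧸ I) ∧
    ringKrullDim (A ⧸ I) ≤ G.betaPath u v + 1 := by
  have hZ : ringKrullDim ℤ = 1 :=
    IsPrincipalIdealRing.ringKrullDim_eq_one ℤ Int.not_isField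
  have hQ : ringKrullDim ℚ = 0 := ringKrullDim_eq_zero_of_field ℚ
  have hbeta : ringKrullDim (A ⧸ I) ≤ G.betaPath u v + 1 := by
    have h := ringKrullDim_le_betaPath huv hx hi hI
    rwa [hZ, add_comm] at h
  have hrat := ringKrullDim_rat_add_one_le hi hI hy hj hJ (n := G.betaPath u v + 1)
    (by exact_mod_cast hbeta)
  -- Subtracting 1 from the comparison over `ℚ` and `ℤ` is legitimate because the bound is finite.
  have hcancel : ∀ {n : ℕ}, ringKrullDim (A ⧸ I) ≤ n + 1 → ringKrullDim (B ⧸ J) ≤ n := by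
    intro n hn
    have h := hrat.trans hn
    generalize ringKrullDim (B ⧸ J) = d at h
    induction d using WithBot.recBotCoe with
    | bot => exact bot_le
    | coe d =>
      have h2 : d + 1 ≤ (n : ℕ∞) + 1 := by exact_mod_cast h
      exact_mod_cast (ENat.add_le_add_iff_right ENat.one_ne_top).mp h2
  -- The `ℤ`-module structure was left arbitrary so that the result fits whichever instance the
  -- final statement carries; all of them are equal.
  obtain rfl : m = (Ideal.instAlgebraQuotient ℤ I).toModule := Subsingleton.elim _ _
  refine ⟨?_, alphaPath_le huv hj hJ hQ (hcancel hbeta), hrat, hbeta⟩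
  tfae_have 1 → 2 := finite_of_isEmpty_dirPath hx hi hI
  tfae_have 2 → 3 := by
    intro h
    have : Algebra.IsIntegral ℤ (A ⧸ I) := @Algebra.IsIntegral.of_finite _ _ _ _ _ h
    exact le_antisymm (hZ ▸ ringKrullDim_le_of_isIntegral ℤ (A ⧸ I))
      (hZ ▸ ringKrullDim_le_ringKrullDim_quotient hi hI)
  tfae_have 3 → 4 := fun h => le_antisymm (by exact_mod_cast hcancel (n := 0) (by simp [h]))
    (hQ ▸ ringKrullDim_le_ringKrullDim_quotient hj hJ)
  tfae_have 4 → 1 := by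
    refine fun h => ⟨fun P => ?_⟩
    have h1 := ringKrullDim_add_le_of_disjoint_dirPaths huv hj hJ (fun _ : Fin 1 => P)
      fun i j hij => absurd (Subsingleton.elim i j) hij
    rw [h, hQ, zero_add] at h1
    exact absurd h1 (by exact_mod_cast Nat.not_succ_le_zero 0)
  tfae_finish

end PathGraph

/-! ### From Khovanov–Rozansky homology to the relation ideal. -/

section Homology

open MvPolynomial

variable {V E : Type*} [Finite E] (G : DirGraph V E) (S : Set E)

theorem mem_annihilator_KRHomology_zero (a : supported ℤ S) :
    a ∈ Module.annihilator (supported ℤ S) (G.KRHomology 0) ↔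
      (supported ℤ S).val a ∈ G.relationIdeal ℤ := by
  rw [annihilator_subalgebra, Ideal.mem_comap, Koszul.annihilator_homology_zero,
    relationIdeal_int]

theorem annihilator_KRHomologyTotal :
    Module.annihilator (supported ℤ S) G.KRHomologyTotal =
      Module.annihilator (supported ℤ S) (G.KRHomology 0) := by
  refine Module.annihilator_dfinsupp.trans (le_antisymm (iInf_le _ 0) (le_iInf fun n => ?_))
  rw [annihilator_subalgebra, annihilator_subalgebra, Koszul.annihilator_homology_zero]
  exact Ideal.comap_mono (Koszul.span_le_annihilator_homology G.relation n)

theorem mem_annihilator_KRHomologyRat_zero (a : supported ℚ S) :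
    a ∈ Module.annihilator (supported ℚ S) (G.KRHomologyRat 0) ↔
      (supported ℚ S).val a ∈ G.relationIdeal ℚ := by
  let _ := MvPolynomial.algebraMvPolynomial (R := ℤ) (S := ℚ) (σ := E)
  rw [annihilator_subalgebra, Ideal.mem_comap]
  have h := Koszul.annihilator_homology_zero_baseChange G.relation (MvPolynomial E ℚ)
  exact iff_of_eq (congrArg (fun I => (supported ℚ S).val a ∈ I) h)

end Homology

end DirGraph

theorem mainTheorem12 {V E : Type*} [Finite V] [Finite E] (G : DirGraph V E) (u v : V)
    (huv : u ≠ v) :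
    [ IsEmpty (G.DirPath u v),
      Module.Finite ℤ (MvPolynomial.supported ℤ (G.gluedEdges u v) ⧸
        Module.annihilator (MvPolynomial.supported ℤ (G.gluedEdges u v))
          ((G.pathGraph u v).KRHomology 0)),
      Module.Finite ℤ (MvPolynomial.supported ℤ (G.gluedEdges u v) ⧸
        Module.annihilator (MvPolynomial.supported ℤ (G.gluedEdges u v))
          (G.pathGraph u v).KRHomologyTotal),
      Kdim (MvPolynomial.supported ℤ (G.gluedEdges u v)) ((G.pathGraph u v).KRHomology 0) = 1,
      Kdim (MvPolynomial.supported ℚ (G.gluedEdges u v)) ((G.pathGraph u v).KRHomologyRat 0) = 0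
    ].TFAE ∧
    (G.alphaPath u v : WithBot ℕ∞) ≤
      Kdim (MvPolynomial.supported ℚ (G.gluedEdges u v)) ((G.pathGraph u v).KRHomologyRat 0) ∧
    Kdim (MvPolynomial.supported ℚ (G.gluedEdges u v)) ((G.pathGraph u v).KRHomologyRat 0) + 1 ≤
      Kdim (MvPolynomial.supported ℤ (G.gluedEdges u v)) ((G.pathGraph u v).KRHomology 0) ∧
    Kdim (MvPolynomial.supported ℤ (G.gluedEdges u v)) ((G.pathGraph u v).KRHomology 0) ≤
      (G.betaPath u v : WithBot ℕ∞) + 1 := by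
  rw [DirGraph.annihilator_KRHomologyTotal]
  obtain ⟨htfae, hbounds⟩ := DirGraph.tfae_and_ringKrullDim_bounds huv
    (MvPolynomial.adjoin_supportedX (k := ℤ) (G.gluedEdges u v))
    (i := (MvPolynomial.supported ℤ (G.gluedEdges u v)).val) (fun _ => rfl)
    ((G.pathGraph u v).mem_annihilator_KRHomology_zero (G.gluedEdges u v))
    (MvPolynomial.adjoin_supportedX (k := ℚ) (G.gluedEdges u v))
    (j := (MvPolynomial.supported ℚ (G.gluedEdges u v)).val) (fun _ => rfl)
    ((G.pathGraph u v).mem_annihilator_KRHomologyRat_zero (G.gluedEdges u v))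
  refine ⟨?_, hbounds⟩
  tfae_have 1 ↔ 2 := htfae.out 0 1
  tfae_have 2 ↔ 3 := Iff.rfl
  tfae_have 2 ↔ 4 := htfae.out 1 2
  tfae_have 4 ↔ 5 := htfae.out 2 3
  tfae_finish
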